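/- For $p\in[0,1]$ let $\mu_p$ be the Bernoulli measure on $2^\omega$ given by $\mu_p(\llbracket\sigma\rrbracket)=p^{\#_0(\sigma)}(1-p)^{\#_1(\sigma)}$, where $\llbracket\sigma\rrbracket$ is the set of infinite extensions of the finite binary string $\sigma$ and $\#_i(\sigma)$ is the number of occurrences of $i$ in $\sigma$. All measures are probability measures. A measure $\nu$ on $2^\omega$ is computable if $\nu(\llbracket\sigma\rrbracket)$ is a computable real number, uniformly in $\sigma$; a measure $\zeta$ on $[0,1]$ is computable if the measures of the relatively open rational intervals of $[0,1]$ are left-c.e. real numbers, uniformly in the interval. A Martin-Löf test for a measure $\mu$ on $2^\omega$ or $[0,1]$ (relative to an oracle) is a sequence $(\mathcal U_i)_{i\in\omega}$ of open sets that is uniformly $\Sigma^0_1$ (relative to the oracle) and satisfies $\mu(\mathcal U_i)\le 2^{-i}$ for every $i$, where the basic open sets are the sets $\llbracket\sigma\rrbracket$ and the relatively open rational intervals, respectively. A point is random if it lies in $\bigcap_i\mathcal U_i$ for no such test. Let $\mathsf{MLR}_\nu$ and $\mathsf{MLR}_\zeta$ be the sets of random points for computable $\nu$ and $\zeta$ without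 oracle, and let $\mathsf{MLR}_{\mu_p}$ be the set of $x\in2^\omega$ that are random for $\mu_p$ relative to the oracle $p$ (given by its binary expansion). **Theorem.** If $\nu$ is a computable measure on $2^\omega$, then there is a computable measure $\zeta$ on $[0,1]$ such that for every $p\in[0,1]$ with $\mathsf{MLR}_\nu\cap\mathsf{MLR}_{\mu_p}\neq\emptyset$ we have $p\in\mathsf{MLR}_\zeta$. -/

import Mathlib

open MeasureTheory ProbabilityTheory

/-! ### Effectively open sets and Martin-Löf randomness -/

/-- A predicate is computably enumerable relative to a set `O` of oracles: it is the domain of a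
partial function that is recursive in `O`. For `O = ∅` this is Mathlib's `REPred`. -/
def REPredIn {α : Type*} [Primcodable α] (O : Set (ℕ →. ℕ)) (P : α → Prop) : Prop :=
  RecursiveIn O fun a => Part.assert (P a) fun _ => Part.some ()

theorem rePredIn_empty_iff {α : Type*} [Primcodable α] {P : α → Prop} :
    REPredIn ∅ P ↔ REPred P :=
  recursiveIn_empty_iff

/-- `U 0, U 1, …` is uniformly `Σ⁰₁` relative to `O`: `U i` is the union of the basic open sets
`B a` over all `a` in `W i`, where `W` is computably enumerable relative to `O`, uniformly in `i`.
Here `B` is a fixed enumeration of a base of the space. -/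
def IsUniformlySigma01 {X α : Type*} [Primcodable α] (O : Set (ℕ →. ℕ)) (B : α → Set X)
    (U : ℕ → Set X) : Prop :=
  ∃ W : ℕ → Set α, REPredIn O (fun q : ℕ × α => q.2 ∈ W q.1) ∧ ∀ i, U i = ⋃ a ∈ W i, B a

/-- A `μ`-Martin-Löf test relative to `O`. -/
def IsMLTest {X α : Type*} [MeasurableSpace X] [Primcodable α] (O : Set (ℕ →. ℕ)) (B : α → Set X)
    (μ : Measure X) (U : ℕ → Set X) : Prop :=
  IsUniformlySigma01 O B U ∧ ∀ i, μ (U i) ≤ (2 : ENNReal)⁻¹ ^ i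

/-- The points that are `μ`-Martin-Löf random relative to `O`: they pass every `μ`-Martin-Löf test
relative to `O`. -/
def MLR {X α : Type*} [MeasurableSpace X] [Primcodable α] (O : Set (ℕ →. ℕ)) (B : α → Set X)
    (μ : Measure X) : Set X :=
  {x | ∀ U : ℕ → Set X, IsMLTest O B μ U → x ∉ ⋂ i, U i}

/-! ### Cantor space -/

/-- The clopen set of all infinite binary sequences that extend `σ` (`false` is the bit `0` and
`true` is the bit `1`). -/
def cantorCylinder (σ : List Bool) : Set (ℕ → Bool) :=
  {x | ∀ i : Fin σ.length, x i = σ.get i}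

/-- A measure on Cantor space is computable if the measures of the cylinders are computable real
numbers, uniformly: on input `σ` and `n` one can compute a dyadic rational at distance at most
`2⁻ⁿ` from the measure of the cylinder of `σ`. -/
def IsComputableCantorMeasure (μ : Measure (ℕ → Bool)) : Prop :=
  ∃ f : List Bool → ℕ → ℕ, Computable₂ f ∧
    ∀ σ n, |μ.real (cantorCylinder σ) - (f σ n : ℝ) / 2 ^ n| ≤ 1 / 2 ^ n

/-- The set of sequences in Cantor space that are Martin-Löf random for `μ`, without oracle. -/
def cantorMLR (μ : Measure (ℕ → Bool)) : Set (ℕ → Bool) := MLR ∅ cantorCylinder μ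

/-! ### Bernoulli measures -/

/-- The Bernoulli measure with parameter `p`: the coordinates are independent, and each of them is
`0` with probability `p` and `1` with probability `1 - p`. -/
noncomputable def bernoulliSeq (p : unitInterval) : Measure (ℕ → Bool) :=
  Measure.infinitePi fun _ : ℕ => bernoulliMeasure false true p

/-- The `n`-th bit (starting with `n = 0`) of the binary expansion of `p`; for `p ≠ 0` it is the
expansion with infinitely many ones. -/
noncomputable def binaryBit (p : unitInterval) (n : ℕ) : ℕ := (⌈(p : ℝ) * 2 ^ (n + 1)⌉₊ - 1) % 2

/-- The real number `p` as an oracle, given by its binary expansion. -/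
noncomputable def realOracle (p : unitInterval) : ℕ →. ℕ := fun n => Part.some (binaryBit p n)

/-- The Bernoulli `p`-random sequences: those that pass every Martin-Löf test relative to `p` for
the Bernoulli measure with parameter `p`. -/
noncomputable def bernoulliMLR (p : unitInterval) : Set (ℕ → Bool) :=
  MLR {realOracle p} cantorCylinder (bernoulliSeq p)

/-! ### The unit interval -/

/-- The open ball of `[0,1]` with center `i / (n + 1)` and radius `j / (n + 1)`, for a code
`(i, j, n)`. The nonempty balls of this form are exactly the nonempty relatively open intervals
of `[0,1]` with rational endpoints. -/
def ratBall (c : ℕ × ℕ × ℕ) : Set unitInterval :=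
  {x | |(x : ℝ) - (c.1 : ℝ) / (c.2.2 + 1)| < (c.2.1 : ℝ) / (c.2.2 + 1)}

/-- A measure on `[0,1]` is computable if the measures of the rational open intervals are
left-c.e. real numbers, uniformly: the pairs of a code of an interval and a nonnegative rational
`q.2.1 / (q.2.2 + 1)` below the measure of this interval are computably enumerable. (A finite union
of rational open intervals is effectively a finite disjoint union of such intervals, so the same
then holds for finite unions of rational balls.) -/
def IsComputableUnitMeasure (ζ : Measure unitInterval) : Prop :=
  REPred fun q : (ℕ × ℕ × ℕ) × (ℕ × ℕ) => (q.2.1 : ℝ) / (q.2.2 + 1) < ζ.real (ratBall q.1)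

/-- The set of points of `[0,1]` that are Martin-Löf random for `ζ`, without oracle. -/
def unitMLR (ζ : Measure unitInterval) : Set unitInterval := MLR ∅ ratBall ζ

/-! ### The definitions agree with the usual formulas -/

theorem cantorCylinder_eq_pi (σ : List Bool) :
    cantorCylinder σ = Set.pi (Finset.range σ.length : Set ℕ) fun i => {b | σ[i]? = some b} := by
  ext x
  simp only [cantorCylinder, Set.mem_ofPred_eq, Set.mem_pi, Finset.coe_range, Set.mem_Iio]
  constructor
  · intro h i hi
    rw [List.getElem?_eq_getElem hi]
    exact congrArg some (h ⟨i, hi⟩).symm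
  · intro h i
    have := h i i.2
    rw [List.getElem?_eq_getElem i.2] at this
    exact (Option.some.inj this).symm

theorem bernoulliSeq_cylinder (p : unitInterval) (σ : List Bool) :
    (bernoulliSeq p).real (cantorCylinder σ)
      = (p : ℝ) ^ σ.count false * (1 - (p : ℝ)) ^ σ.count true := by
  rw [cantorCylinder_eq_pi, bernoulliSeq, measureReal_def, Measure.infinitePi_pi _ (by
    intro i _; exact DiscreteMeasurableSpace.forall_measurableSet _), ENNReal.toReal_prod]
  induction σ with
  | nil => simp
  | cons b σ ih =>
    rw [List.length_cons, Finset.prod_range_succ']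
    simp only [List.getElem?_cons_succ, List.getElem?_cons_zero]
    rw [ih]
    have key : ((bernoulliMeasure false true p) {a | some b = some a}).toReal
        = if b then 1 - (p : ℝ) else p := by
      rw [← measureReal_def, bernoulliMeasure_real_apply p
        (DiscreteMeasurableSpace.forall_measurableSet _)]
      cases b <;> simp
    rw [key]
    cases b <;> simp <;> ring

theorem binaryBit_hasSum (p : unitInterval) :
    HasSum (fun n => (binaryBit p n : ℝ) / 2 ^ (n + 1)) (p : ℝ) := by
  rcases eq_or_lt_of_le p.2.1 with h0 | h0
  · have : ∀ n, binaryBit p n = 0 := by intro n; simp [binaryBit, ← h0]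
    simp only [this, ← h0]
    simp
  · have hpos : ∀ n : ℕ, 0 < ⌈(p : ℝ) * 2 ^ n⌉₊ := fun n => Nat.ceil_pos.2 (by positivity)
    have hstep : ∀ n : ℕ, (⌈(p : ℝ) * 2 ^ (n + 1)⌉₊ - 1) / 2 = ⌈(p : ℝ) * 2 ^ n⌉₊ - 1 := by
      intro n
      have h1 : ⌈(p : ℝ) * 2 ^ (n + 1)⌉₊ ≤ 2 * ⌈(p : ℝ) * 2 ^ n⌉₊ := by
        apply Nat.ceil_le.2
        have := Nat.le_ceil ((p : ℝ) * 2 ^ n)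
        push_cast
        rw [pow_succ]
        linarith
      have h2 : 2 * (⌈(p : ℝ) * 2 ^ n⌉₊ - 1) < ⌈(p : ℝ) * 2 ^ (n + 1)⌉₊ := by
        apply Nat.lt_ceil.2
        have := Nat.ceil_lt_add_one (show 0 ≤ (p : ℝ) * 2 ^ n by positivity)
        rw [Nat.cast_mul, Nat.cast_sub (hpos n), pow_succ]
        push_cast
        linarith
      have := hpos n
      omega
    have hsum : ∀ n : ℕ, ∑ i ∈ Finset.range n, (binaryBit p i : ℝ) / 2 ^ (i + 1)
        = ((⌈(p : ℝ) * 2 ^ n⌉₊ - 1 : ℕ) : ℝ) / 2 ^ n := by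
      intro n
      induction n with
      | zero =>
        have : ⌈(p : ℝ)⌉₊ ≤ 1 := Nat.ceil_le.2 (by simpa using p.2.2)
        simp [Nat.sub_eq_zero_of_le this]
      | succ n ih =>
        rw [Finset.sum_range_succ, ih]
        have e : ⌈(p : ℝ) * 2 ^ (n + 1)⌉₊ - 1
            = 2 * (⌈(p : ℝ) * 2 ^ n⌉₊ - 1) + binaryBit p n := by
          rw [← hstep n, binaryBit]
          omega
        rw [e]
        push_cast
        field_simp
        ring
    rw [hasSum_iff_tendsto_nat_of_nonneg (fun n => by positivity)]
    simp only [hsum]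
    have hlim : Filter.Tendsto (fun n : ℕ => (p : ℝ) - (1 / 2) ^ n) Filter.atTop (nhds (p : ℝ)) := by
      simpa using tendsto_const_nhds.sub
        (tendsto_pow_atTop_nhds_zero_of_lt_one (by norm_num : (0 : ℝ) ≤ 1 / 2) (by norm_num))
    refine tendsto_of_tendsto_of_tendsto_of_le_of_le hlim tendsto_const_nhds ?_ ?_
    · intro n
      have := Nat.le_ceil ((p : ℝ) * 2 ^ n)
      simp only
      rw [Nat.cast_sub (hpos n), le_div_iff₀ (by positivity), sub_mul, ← mul_pow]
      norm_num
      linarith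
    · intro n
      have := Nat.ceil_lt_add_one (show 0 ≤ (p : ℝ) * 2 ^ n by positivity)
      simp only
      rw [Nat.cast_sub (hpos n), div_le_iff₀ (by positivity)]
      push_cast
      linarith

/-! ### Computably enumerable predicates -/

section Enumerable

variable {α β : Type*} [Primcodable α] [Primcodable β]

/-! A Bernoulli random sequence determines its parameter as the limiting frequency of zeros. If that
limit were a total computable map Φ with Φ(x) = p, the image measure of `ν` under Φ would be
computable and conservation of randomness would finish. But the limit need not exist, and its rate
of convergence depends on x.

Both defects are cured by clamping. For each c, the frequencies along the lengths 16 ^ k are forced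
to move by at most 2 * 2 ^ c / 2 ^ k per step, so their limit `clampedLimit c` is total and
computable, uniformly in c. The measure ζ is the mixture of the images of `ν` under these maps with
weights 2 ^ -(c + 1).

Three facts carry the proof. The mixture is computable (`isComputableUnitMeasure_clampedMeasure`),
because membership of the limit in a rational ball is certified by finitely many bits. If x is
Bernoulli random relative to p, Chebyshev's inequality gives a test showing that from some k on the
frequency is within about 2 ^ -k of p; a large c absorbs the finitely many exceptions, the clamp
never acts, and `clampedLimit c x` is p (`exists_clampedLimit_eq`). Finally, each image measure is
at most 2 ^ (c + 1) times the mixture, so a test for the mixture pulls back to a test for `ν`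
(`isMLTest_preimage_clampedLimit`). -/

theorem REPred.comp {p : β → Prop} (hp : REPred p) {f : α → β} (hf : Computable f) :
    REPred fun a => p (f a) :=
  Partrec.comp hp hf

/-- Evaluation of a code with a step bound is primitive recursive; the number n is that bound. -/
theorem REPred.exists_primrec₂ {p : α → Prop} (hp : REPred p) :
    ∃ R : α → ℕ → Bool, Primrec₂ R ∧ ∀ a, p a ↔ ∃ n, R a n = true := by
  obtain ⟨c, hc⟩ := Nat.Partrec.Code.exists_code.1 hp
  refine ⟨fun a k => (Nat.Partrec.Code.evaln k c (Encodable.encode a)).isSome, ?_, fun a => ?_⟩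
  · exact Primrec.option_isSome.comp (Nat.Partrec.Code.primrec_evaln.comp
      ((Primrec.snd.pair (Primrec.const c)).pair (Primrec.encode.comp Primrec.fst)))
  · have h : (Nat.Partrec.Code.eval c (Encodable.encode a)).Dom ↔ p a := by
      rw [hc]
      simp [Part.assert]
    rw [← h, Part.dom_iff_mem]
    simp only [Nat.Partrec.Code.evaln_complete, Option.isSome_iff_exists]
    exact exists_comm

theorem REPred.of_computable₂ {R : α → ℕ → Bool} (hR : Computable₂ R) :
    REPred fun a => ∃ n, R a n = true := by
  refine (Partrec.dom_re (Partrec.rfind hR.partrec₂)).of_eq fun a => ?_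
  simp [Nat.rfind_dom]

theorem REPred.exists {p : α × β → Prop} (hp : REPred p) : REPred fun a => ∃ b, p (a, b) := by
  obtain ⟨R, hR, h⟩ := hp.exists_primrec₂
  -- Dovetailing: m codes a pair of a witness and a step bound; numbers that code nothing count as
  -- failures.
  have hQ : Primrec₂ fun (a : α) (m : ℕ) =>
      Option.casesOn (motive := fun _ => Bool) (Encodable.decode (α := β × ℕ) m) false
        fun q => R (a, q.1) q.2 := by
    refine Primrec.option_casesOn (Primrec.decode.comp Primrec.snd) (Primrec.const false) ?_
    exact hR.comp ((Primrec.fst.comp Primrec.fst).pair (Primrec.fst.comp Primrec.snd))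
      (Primrec.snd.comp Primrec.snd)
  refine (REPred.of_computable₂ hQ.to_comp).of_eq fun a => ?_
  simp only [h]
  constructor
  · rintro ⟨m, hm⟩
    cases hd : Encodable.decode (α := β × ℕ) m with
    | none => simp [hd] at hm
    | some q => exact ⟨q.1, q.2, by simpa [hd] using hm⟩
  · rintro ⟨b, n, hn⟩
    exact ⟨Encodable.encode (b, n), by simpa using hn⟩

theorem REPred.and {p q : α → Prop} (hp : REPred p) (hq : REPred q) :
    REPred fun a => p a ∧ q a := by
  obtain ⟨R, hR, h⟩ := hp.exists_primrec₂
  obtain ⟨R', hR', h'⟩ := hq.exists_primrec₂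
  have hQ : Primrec fun b : α × ℕ × ℕ => R b.1 b.2.1 && R' b.1 b.2.2 :=
    Primrec.and.comp (hR.comp Primrec.fst (Primrec.fst.comp Primrec.snd))
      (hR'.comp Primrec.fst (Primrec.snd.comp Primrec.snd))
  have hc : REPred fun b : α × ℕ × ℕ => (R b.1 b.2.1 && R' b.1 b.2.2) = true :=
    (ComputablePred.computable_iff.2 ⟨_, hQ.to_comp, rfl⟩).to_re
  refine hc.exists.of_eq fun a => ?_
  simp only [h, h', Bool.and_eq_true, Prod.exists, exists_and_left, exists_and_right]

theorem ComputablePred.nat_lt {f g : α → ℕ} (hf : Computable f) (hg : Computable g) :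
    ComputablePred fun a => f a < g a :=
  ComputablePred.computable_iff.2 ⟨_, (Primrec.nat_lt.decide.to_comp).comp hf hg, by simp⟩

theorem Computable.sum_range {f : α → ℕ → ℕ} (hf : Computable₂ f) {n : α → ℕ}
    (hn : Computable n) : Computable fun a => ∑ i ∈ Finset.range (n a), f a i := by
  refine (Computable.nat_rec (f := n) (g := fun _ => 0)
    (h := fun a (q : ℕ × ℕ) => q.2 + f a q.1) hn (Computable.const 0) ?_).of_eq fun a => ?_
  · exact Primrec.nat_add.to_comp.comp (Computable.snd.comp Computable.snd)
      (hf.comp Computable.fst (Computable.fst.comp Computable.snd))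
  · induction n a with
    | zero => rfl
    | succ k ih => rw [Finset.sum_range_succ, ← ih]

theorem Primrec.sum_range {f : α → ℕ → ℕ} (hf : Primrec₂ f) {n : α → ℕ}
    (hn : Primrec n) : Primrec fun a => ∑ i ∈ Finset.range (n a), f a i := by
  refine (Primrec.nat_rec' (f := n) (g := fun _ => 0)
    (h := fun a (q : ℕ × ℕ) => q.2 + f a q.1) hn (Primrec.const 0) ?_).of_eq fun a => ?_
  · exact Primrec.nat_add.comp (Primrec.snd.comp Primrec.snd)
      (hf.comp Primrec.fst (Primrec.fst.comp Primrec.snd))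
  · induction n a with
    | zero => rfl
    | succ k ih => rw [Finset.sum_range_succ, ← ih]

theorem Primrec.nat_pow : Primrec₂ ((· ^ ·) : ℕ → ℕ → ℕ) := by
  refine (Primrec.nat_rec' (f := fun q : ℕ × ℕ => q.2) (g := fun _ => 1)
    (h := fun q (r : ℕ × ℕ) => r.2 * q.1) Primrec.snd (Primrec.const 1) ?_).of_eq fun q => ?_
  · exact Primrec.nat_mul.comp (Primrec.snd.comp Primrec.snd) (Primrec.fst.comp Primrec.fst)
  · obtain ⟨a, n⟩ := q
    induction n with
    | zero => rfl
    | succ k ih => exact (congrArg (· * a) ih).trans (pow_succ a k).symm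

theorem Primrec.nat_testBit : Primrec₂ Nat.testBit := by
  have h : PrimrecPred fun q : ℕ × ℕ => q.1 / 2 ^ q.2 % 2 = 1 :=
    Primrec.eq.comp (Primrec.nat_mod.comp (Primrec.nat_div.comp Primrec.fst
      (Primrec.nat_pow.comp (Primrec.const 2) Primrec.snd)) (Primrec.const 2)) (Primrec.const 1)
  exact h.decide.of_eq fun q => (Nat.testBit_eq_decide_div_mod_eq).symm

/-- Deciding a computable property of the value of an oracle computation. -/
theorem REPredIn.of_recursiveIn {O : Set (ℕ →. ℕ)} {g : ℕ → ℕ}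
    (hg : Nat.RecursiveIn O fun n => Part.some (g n)) {Q : α × ℕ → Prop} (hQ : REPred Q)
    {l : α → ℕ} (hl : Primrec l) : REPredIn O fun a => Q (a, g (l a)) := by
  -- The default 0 is harmless: if n codes no element of `α`, the pair formed below codes no element
  -- of `α × ℕ`, and the computation diverges.
  have hl' : Nat.Primrec fun n => Option.casesOn (motive := fun _ => ℕ)
      (Encodable.decode (α := α) n) 0 l :=
    Primrec.nat_iff.1 (Primrec.option_casesOn Primrec.decode (Primrec.const 0)
      (hl.comp Primrec.snd))
  have h := (hQ.recursiveIn (O := O)).comp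
    ((Nat.Primrec.recursiveIn (O := O) Nat.Primrec.id).pair (hg.comp hl'.recursiveIn))
  refine h.of_eq fun n => ?_
  cases hd : Encodable.decode (α := α) n with
  | none => simp [Seq.seq, hd]
  | some a => simp [Seq.seq, hd]

end Enumerable

/-! ### Clamped frequencies -/

/-- The number of zeros among the first `n` bits of `x`. -/
def zeroCount (x : ℕ → Bool) (n : ℕ) : ℕ := ∑ i ∈ Finset.range n, if x i then 0 else 1

/-- The number of zeros among the first `16 ^ k` bits of `x`, modified in such a way that the
quotients by `16 ^ k` change by at most `2 * 2 ^ c / 2 ^ k` from step `k` to step `k + 1`. -/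
def clampedCount (c : ℕ) (x : ℕ → Bool) : ℕ → ℕ
  | 0 => zeroCount x 1
  | k + 1 => min (max (zeroCount x (16 ^ (k + 1))) (16 * clampedCount c x k - 32 * 2 ^ c * 8 ^ k))
      (16 * clampedCount c x k + 32 * 2 ^ c * 8 ^ k)

theorem zeroCount_congr {x y : ℕ → Bool} {n : ℕ} (h : ∀ i < n, x i = y i) :
    zeroCount x n = zeroCount y n :=
  Finset.sum_congr rfl fun i hi => by rw [h i (Finset.mem_range.1 hi)]

theorem zeroCount_le (x : ℕ → Bool) (n : ℕ) : zeroCount x n ≤ n :=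
  (Finset.sum_le_card_nsmul _ _ 1 fun i _ => by split <;> simp).trans (by simp)

theorem clampedCount_congr {c : ℕ} {x y : ℕ → Bool} {k : ℕ} (h : ∀ i < 16 ^ k, x i = y i) :
    clampedCount c x k = clampedCount c y k := by
  induction k with
  | zero => exact zeroCount_congr h
  | succ k ih =>
    rw [clampedCount, clampedCount, zeroCount_congr h,
      ih fun i hi => h i (hi.trans (Nat.pow_lt_pow_right (by norm_num) k.lt_succ_self))]

theorem clampedCount_le (c : ℕ) (x : ℕ → Bool) (k : ℕ) : clampedCount c x k ≤ 16 ^ k := by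
  induction k with
  | zero => exact zeroCount_le x 1
  | succ k ih =>
    have := zeroCount_le x (16 ^ (k + 1))
    rw [clampedCount]
    refine (min_le_left _ _).trans (max_le this ?_)
    rw [pow_succ]
    omega

theorem measurable_zeroCount (n : ℕ) : Measurable fun x => zeroCount x n :=
  Finset.measurable_fun_sum _ fun i _ =>
    (measurable_of_countable fun b : Bool => if b then 0 else 1).comp (measurable_pi_apply i)

theorem measurable_clampedCount (c k : ℕ) : Measurable fun x => clampedCount c x k := by
  induction k with
  | zero => exact measurable_zeroCount 1
  | succ k ih =>
    exact (measurable_of_countable fun q : ℕ × ℕ =>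
      min (max q.1 (16 * q.2 - 32 * 2 ^ c * 8 ^ k)) (16 * q.2 + 32 * 2 ^ c * 8 ^ k)).comp
        ((measurable_zeroCount _).prodMk ih)

/-- The `k`-th clamped frequency of zeros in `x`. -/
noncomputable def clampedFreq (c : ℕ) (x : ℕ → Bool) (k : ℕ) : unitInterval :=
  ⟨(clampedCount c x k : ℝ) / 16 ^ k, by positivity,
    div_le_one_of_le₀ (by exact_mod_cast clampedCount_le c x k) (by positivity)⟩

/-- The clamp allows 32 * 2 ^ c * 8 ^ k out of 16 ^ (k + 1), which is 2 * 2 ^ c / 2 ^ k. The bound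
is written in the form that the lemmas on geometric Cauchy sequences expect. -/
theorem dist_clampedFreq_succ (c : ℕ) (x : ℕ → Bool) (k : ℕ) :
    dist (clampedFreq c x k) (clampedFreq c x (k + 1)) ≤ 4 * 2 ^ c / 2 / 2 ^ k := by
  have h1 : 16 * clampedCount c x k ≤ clampedCount c x (k + 1) + 32 * 2 ^ c * 8 ^ k := by
    rw [clampedCount]; omega
  have h2 : clampedCount c x (k + 1) ≤ 16 * clampedCount c x k + 32 * 2 ^ c * 8 ^ k := by
    rw [clampedCount]; omega
  have h1' : 16 * (clampedCount c x k : ℝ) ≤ clampedCount c x (k + 1) + 32 * 2 ^ c * 8 ^ k := by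
    exact_mod_cast h1
  have h2' : (clampedCount c x (k + 1) : ℝ) ≤ 16 * clampedCount c x k + 32 * 2 ^ c * 8 ^ k := by
    exact_mod_cast h2
  have e8 : (8 : ℝ) ^ k * 2 ^ k = 16 ^ k := by rw [← mul_pow]; norm_num
  have e : (4 * 2 ^ c / 2 / 2 ^ k : ℝ) = 32 * 2 ^ c * 8 ^ k / 16 ^ (k + 1) := by
    rw [pow_succ, ← e8]; field_simp; norm_num
  have e' : ((clampedFreq c x k : unitInterval) : ℝ)
      = 16 * (clampedCount c x k : ℝ) / 16 ^ (k + 1) := by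
    rw [clampedFreq, pow_succ]; field_simp
  rw [Subtype.dist_eq, Real.dist_eq, e', e, clampedFreq, ← sub_div, abs_div,
    abs_of_pos (show (0 : ℝ) < 16 ^ (k + 1) by positivity)]
  gcongr
  rw [abs_le]
  constructor <;> linarith

theorem exists_tendsto_clampedFreq (c : ℕ) (x : ℕ → Bool) :
    ∃ p, Filter.Tendsto (clampedFreq c x) Filter.atTop (nhds p) :=
  cauchySeq_tendsto_of_complete (cauchySeq_of_le_geometric_two (dist_clampedFreq_succ c x))

/-- The limit of the clamped frequencies of zeros in `x`. -/
noncomputable def clampedLimit (c : ℕ) (x : ℕ → Bool) : unitInterval :=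
  (exists_tendsto_clampedFreq c x).choose

theorem tendsto_clampedFreq (c : ℕ) (x : ℕ → Bool) :
    Filter.Tendsto (clampedFreq c x) Filter.atTop (nhds (clampedLimit c x)) :=
  (exists_tendsto_clampedFreq c x).choose_spec

theorem dist_clampedFreq_clampedLimit (c : ℕ) (x : ℕ → Bool) (k : ℕ) :
    dist (clampedFreq c x k) (clampedLimit c x) ≤ 4 * 2 ^ c / 2 ^ k :=
  dist_le_of_le_geometric_two_of_tendsto (dist_clampedFreq_succ c x) (tendsto_clampedFreq c x) k

theorem measurable_clampedLimit (c : ℕ) : Measurable (clampedLimit c) := by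
  refine measurable_of_tendsto_metrizable (f := fun k x => clampedFreq c x k) (fun k => ?_)
    (tendsto_pi_nhds.2 (tendsto_clampedFreq c))
  exact Measurable.subtype_mk
    (((measurable_of_countable fun m : ℕ => (m : ℝ)).comp (measurable_clampedCount c k)).div_const _)

/-- By the triangle inequality through p, consecutive frequencies differ by at most 2 ^ c / 2 ^ k +
2 ^ c / 2 ^ (k + 1). This is below the permitted 2 * 2 ^ c / 2 ^ k, so the clamp stays inactive. In
counts: 16 + 8 = 24 against 32. -/
theorem clampedCount_eq_zeroCount {c : ℕ} {x : ℕ → Bool} {p : ℝ}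
    (h : ∀ k, |(zeroCount x (16 ^ k) : ℝ) / 16 ^ k - p| ≤ 2 ^ c / 2 ^ k) (k : ℕ) :
    clampedCount c x k = zeroCount x (16 ^ k) := by
  induction k with
  | zero => rfl
  | succ k ih =>
    have e8 : (8 : ℝ) ^ k * 2 ^ k = 16 ^ k := by rw [← mul_pow]; norm_num
    have h0 := abs_le.1 (h k)
    have h1 := abs_le.1 (h (k + 1))
    have hpos : (0 : ℝ) < 16 ^ (k + 1) := by positivity
    have hb : (2 : ℝ) ^ c / 2 ^ k = 16 * 2 ^ c * 8 ^ k / 16 ^ (k + 1) := by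
      rw [pow_succ, ← e8]; field_simp
    have hb' : (2 : ℝ) ^ c / 2 ^ (k + 1) = 8 * 2 ^ c * 8 ^ k / 16 ^ (k + 1) := by
      rw [pow_succ, pow_succ, ← e8]; field_simp; norm_num
    have hz : (zeroCount x (16 ^ k) : ℝ) / 16 ^ k = 16 * zeroCount x (16 ^ k) / 16 ^ (k + 1) := by
      rw [pow_succ]; field_simp
    rw [hb, hz] at h0
    rw [hb'] at h1
    have hD : (0 : ℝ) < 2 ^ c * 8 ^ k := by positivity
    have u : (16 * zeroCount x (16 ^ k) : ℝ)
        ≤ zeroCount x (16 ^ (k + 1)) + 32 * 2 ^ c * 8 ^ k := by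
      have : (16 * zeroCount x (16 ^ k) : ℝ) / 16 ^ (k + 1)
          ≤ (zeroCount x (16 ^ (k + 1)) + 24 * 2 ^ c * 8 ^ k) / 16 ^ (k + 1) := by
        have e : ((zeroCount x (16 ^ (k + 1)) + 24 * 2 ^ c * 8 ^ k) / 16 ^ (k + 1) : ℝ)
          = zeroCount x (16 ^ (k + 1)) / 16 ^ (k + 1) + 16 * 2 ^ c * 8 ^ k / 16 ^ (k + 1)
            + 8 * 2 ^ c * 8 ^ k / 16 ^ (k + 1) := by ring
        rw [e]; linarith
      have := (div_le_div_iff_of_pos_right hpos).1 this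
      linarith
    have v : (zeroCount x (16 ^ (k + 1)) : ℝ)
        ≤ 16 * zeroCount x (16 ^ k) + 32 * 2 ^ c * 8 ^ k := by
      have : (zeroCount x (16 ^ (k + 1)) : ℝ) / 16 ^ (k + 1)
          ≤ (16 * zeroCount x (16 ^ k) + 24 * 2 ^ c * 8 ^ k) / 16 ^ (k + 1) := by
        have e : ((16 * zeroCount x (16 ^ k) + 24 * 2 ^ c * 8 ^ k) / 16 ^ (k + 1) : ℝ)
          = 16 * zeroCount x (16 ^ k) / 16 ^ (k + 1) + 16 * 2 ^ c * 8 ^ k / 16 ^ (k + 1)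
            + 8 * 2 ^ c * 8 ^ k / 16 ^ (k + 1) := by ring
        rw [e]; linarith
      have := (div_le_div_iff_of_pos_right hpos).1 this
      linarith
    have u' : 16 * zeroCount x (16 ^ k) ≤ zeroCount x (16 ^ (k + 1)) + 32 * 2 ^ c * 8 ^ k := by
      exact_mod_cast u
    have v' : zeroCount x (16 ^ (k + 1)) ≤ 16 * zeroCount x (16 ^ k) + 32 * 2 ^ c * 8 ^ k := by
      exact_mod_cast v
    rw [clampedCount, ih, max_eq_left (by omega), min_eq_left v']

theorem tendsto_pow_div_two_pow (a : ℝ) :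
    Filter.Tendsto (fun k : ℕ => a / 2 ^ k) Filter.atTop (nhds 0) := by
  have := (tendsto_pow_atTop_nhds_zero_of_lt_one (r := (1 / 2 : ℝ)) (by norm_num)
    (by norm_num)).const_mul a
  simpa [div_eq_mul_inv] using this

theorem clampedLimit_eq {c : ℕ} {x : ℕ → Bool} {p : unitInterval}
    (h : ∀ k, |(zeroCount x (16 ^ k) : ℝ) / 16 ^ k - p| ≤ 2 ^ c / 2 ^ k) :
    clampedLimit c x = p := by
  refine tendsto_nhds_unique (tendsto_clampedFreq c x) ?_
  rw [tendsto_iff_dist_tendsto_zero]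
  refine squeeze_zero (fun _ => dist_nonneg) (fun k => ?_) (tendsto_pow_div_two_pow (2 ^ c))
  have e : (clampedFreq c x k : ℝ) = zeroCount x (16 ^ k) / 16 ^ k := by
    rw [← clampedCount_eq_zeroCount h]; rfl
  rw [Subtype.dist_eq, Real.dist_eq, e]
  exact h k

/-- The `k`-th clamped frequency of `x` certifies that their limit is in the ball with code `b`. -/
def ClampedCertified (b : ℕ × ℕ × ℕ) (c : ℕ) (x : ℕ → Bool) (k : ℕ) : Prop :=
  clampedCount c x k * (b.2.2 + 1) * 2 ^ k + 4 * 2 ^ c * 16 ^ k * (b.2.2 + 1)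
      < (b.1 + b.2.1) * 16 ^ k * 2 ^ k ∧
    b.1 * 16 ^ k * 2 ^ k + 4 * 2 ^ c * 16 ^ k * (b.2.2 + 1)
      < b.2.1 * 16 ^ k * 2 ^ k + clampedCount c x k * (b.2.2 + 1) * 2 ^ k

instance (b : ℕ × ℕ × ℕ) (c : ℕ) (x : ℕ → Bool) (k : ℕ) : Decidable (ClampedCertified b c x k) :=
  inferInstanceAs (Decidable (_ ∧ _))

/-- The term 4 * 2 ^ c / 2 ^ k bounds the distance from the k-th frequency to the limit. The
definition clears denominators and avoids subtraction, to be visibly primitive recursive. -/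
theorem clampedCertified_iff {b : ℕ × ℕ × ℕ} {c : ℕ} {x : ℕ → Bool} {k : ℕ} :
    ClampedCertified b c x k ↔ |(clampedFreq c x k : ℝ) - (b.1 : ℝ) / (b.2.2 + 1)|
      + 4 * 2 ^ c / 2 ^ k < (b.2.1 : ℝ) / (b.2.2 + 1) := by
  obtain ⟨i, j, n⟩ := b
  have hM : (0 : ℝ) < (n + 1) * 16 ^ k * 2 ^ k := by positivity
  rw [← lt_sub_iff_add_lt, abs_sub_lt_iff, ClampedCertified]
  simp only [clampedFreq]
  rw [← Nat.cast_lt (α := ℝ), ← Nat.cast_lt (α := ℝ)]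
  push_cast
  have aux : ∀ {a b c d : ℝ}, b - a = (n + 1) * 16 ^ k * 2 ^ k * (d - c) → (a < b ↔ c < d) := by
    intro a b c d h
    rw [← sub_pos, h, mul_pos_iff_of_pos_left hM, sub_pos]
  refine and_congr (aux ?_) (aux ?_)
  · field_simp
    ring
  · field_simp
    ring

/-- The error term halves from k to k + 1, and the frequency moves by at most the half that is lost.
-/
theorem ClampedCertified.succ {b : ℕ × ℕ × ℕ} {c : ℕ} {x : ℕ → Bool} {k : ℕ}
    (h : ClampedCertified b c x k) : ClampedCertified b c x (k + 1) := by
  rw [clampedCertified_iff] at h ⊢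
  refine lt_of_le_of_lt ?_ h
  have hd := dist_clampedFreq_succ c x k
  rw [dist_comm, Subtype.dist_eq, Real.dist_eq] at hd
  have ht := abs_sub_le (clampedFreq c x (k + 1) : ℝ) (clampedFreq c x k) (b.1 / (b.2.2 + 1))
  have e : (4 * 2 ^ c / 2 ^ k : ℝ) = 4 * 2 ^ c / 2 / 2 ^ k + 4 * 2 ^ c / 2 ^ (k + 1) := by
    rw [pow_succ]; field_simp; norm_num
  rw [e]
  linarith

theorem clampedCertified_mono (b : ℕ × ℕ × ℕ) (c : ℕ) (x : ℕ → Bool) :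
    Monotone (ClampedCertified b c x) :=
  monotone_nat_of_le_succ fun _ h => h.succ

/-- The ball is open and the error term tends to 0, so a limit inside is eventually certified; the
converse is the tail bound. -/
theorem clampedLimit_mem_ratBall {b : ℕ × ℕ × ℕ} {c : ℕ} {x : ℕ → Bool} :
    clampedLimit c x ∈ ratBall b ↔ ∃ k, ClampedCertified b c x k := by
  simp only [clampedCertified_iff]
  constructor
  · intro h
    have ht : Filter.Tendsto (fun k => |(clampedFreq c x k : ℝ) - (b.1 : ℝ) / (b.2.2 + 1)|
        + 4 * 2 ^ c / 2 ^ k) Filter.atTop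
        (nhds (|(clampedLimit c x : ℝ) - (b.1 : ℝ) / (b.2.2 + 1)| + 0)) :=
      ((((continuous_subtype_val.tendsto _).comp (tendsto_clampedFreq c x)).sub_const _).abs).add
        (tendsto_pow_div_two_pow _)
    rw [add_zero] at ht
    exact (ht.eventually (gt_mem_nhds h)).exists
  · rintro ⟨k, hk⟩
    have hd := dist_clampedFreq_clampedLimit c x k
    rw [dist_comm, Subtype.dist_eq, Real.dist_eq] at hd
    have ht := abs_sub_le (clampedLimit c x : ℝ) (clampedFreq c x k) (b.1 / (b.2.2 + 1))
    show |(clampedLimit c x : ℝ) - _| < _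
    linarith

/-! ### Primitive recursiveness of clamped counts and certificates -/

section Computability

variable {α : Type*} [Primcodable α]

theorem primrec_zeroCount {x : α → ℕ → Bool} (hx : Primrec₂ x) :
    Primrec₂ fun a n => zeroCount (x a) n := by
  refine Primrec.sum_range (f := fun (q : α × ℕ) i => if x q.1 i then 0 else 1) ?_ Primrec.snd
  exact (Primrec.cond (hx.comp (Primrec.fst.comp Primrec.fst) Primrec.snd) (Primrec.const 0)
    (Primrec.const 1)).of_eq fun q => by
      dsimp only; cases x q.1.1 q.2 <;> rfl

theorem primrec_clampedCount {x : α → ℕ → Bool} (hx : Primrec₂ x) {c k : α → ℕ}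
    (hc : Primrec c) (hk : Primrec k) : Primrec fun a => clampedCount (c a) (x a) (k a) := by
  have hP : ∀ (m : ℕ), Primrec fun n : ℕ => m ^ n := fun m =>
    Primrec.nat_pow.comp (Primrec.const m) Primrec.id
  have h16 : Primrec fun q : α × ℕ × ℕ => 16 * q.2.2 :=
    Primrec.nat_mul.comp (Primrec.const 16) (Primrec.snd.comp Primrec.snd)
  have hD : Primrec fun q : α × ℕ × ℕ => 32 * 2 ^ c q.1 * 8 ^ q.2.1 :=
    Primrec.nat_mul.comp (Primrec.nat_mul.comp (Primrec.const 32)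
      ((hP 2).comp (hc.comp Primrec.fst))) ((hP 8).comp (Primrec.fst.comp Primrec.snd))
  have hS : Primrec fun q : α × ℕ × ℕ => zeroCount (x q.1) (16 ^ (q.2.1 + 1)) :=
    (primrec_zeroCount hx).comp Primrec.fst
      ((hP 16).comp (Primrec.succ.comp (Primrec.fst.comp Primrec.snd)))
  refine (Primrec.nat_rec' (f := k) (g := fun a => zeroCount (x a) 1)
    (h := fun a q => min (max (zeroCount (x a) (16 ^ (q.1 + 1))) (16 * q.2 - 32 * 2 ^ c a * 8 ^ q.1))
      (16 * q.2 + 32 * 2 ^ c a * 8 ^ q.1)) hk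
    ((primrec_zeroCount hx).comp Primrec.id (Primrec.const 1)) ?_).of_eq fun a => ?_
  · exact Primrec.nat_min.comp (Primrec.nat_max.comp hS (Primrec.nat_sub.comp h16 hD))
      (Primrec.nat_add.comp h16 hD)
  · induction k a with
    | zero => rfl
    | succ n ih => rw [clampedCount, ← ih]

theorem primrec_clampedCertified {x : α → ℕ → Bool} (hx : Primrec₂ x) {b : α → ℕ × ℕ × ℕ}
    {c k : α → ℕ} (hb : Primrec b) (hc : Primrec c) (hk : Primrec k) :
    PrimrecPred fun a => ClampedCertified (b a) (c a) (x a) (k a) := by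
  have hG := primrec_clampedCount hx hc hk
  have h1 : Primrec fun a => (b a).1 := Primrec.fst.comp hb
  have h2 : Primrec fun a => (b a).2.1 := Primrec.fst.comp (Primrec.snd.comp hb)
  have h3 : Primrec fun a => (b a).2.2 + 1 :=
    Primrec.succ.comp (Primrec.snd.comp (Primrec.snd.comp hb))
  have p2 : Primrec fun a => 2 ^ k a := Primrec.nat_pow.comp (Primrec.const 2) hk
  have p16 : Primrec fun a => 16 ^ k a := Primrec.nat_pow.comp (Primrec.const 16) hk
  have e : Primrec fun a => 4 * 2 ^ c a * 16 ^ k a * ((b a).2.2 + 1) :=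
    Primrec.nat_mul.comp (Primrec.nat_mul.comp (Primrec.nat_mul.comp (Primrec.const 4)
      (Primrec.nat_pow.comp (Primrec.const 2) hc)) p16) h3
  have g : Primrec fun a => clampedCount (c a) (x a) (k a) * ((b a).2.2 + 1) * 2 ^ k a :=
    Primrec.nat_mul.comp (Primrec.nat_mul.comp hG h3) p2
  have s : ∀ {u : α → ℕ}, Primrec u → Primrec fun a => u a * 16 ^ k a * 2 ^ k a := fun hu =>
    Primrec.nat_mul.comp (Primrec.nat_mul.comp hu p16) p2
  exact (Primrec.nat_lt.comp (Primrec.nat_add.comp g e) (s (Primrec.nat_add.comp h1 h2))).and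
    (Primrec.nat_lt.comp (Primrec.nat_add.comp (s h1) e) (Primrec.nat_add.comp (s h2) g))

end Computability

/-! ### The mixture of the distributions of the limits of clamped frequencies -/

/-- The string of the last `n` binary digits of `m`, starting with the least significant one. -/
def bitString (n m : ℕ) : List Bool := (List.range n).map m.testBit

theorem mem_cantorCylinder_bitString {n m : ℕ} {x : ℕ → Bool} :
    x ∈ cantorCylinder (bitString n m) ↔ ∀ i < n, x i = m.testBit i := by
  simp only [cantorCylinder, Set.mem_ofPred_eq]
  constructor
  · intro h i hi
    simpa [bitString] using h ⟨i, by simpa [bitString] using hi⟩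
  · intro h i
    have hi : (i : ℕ) < n := by simpa [bitString] using i.2
    show x i = (bitString n m)[(i : ℕ)]
    simpa [bitString] using h i hi

theorem measurableSet_cantorCylinder (σ : List Bool) : MeasurableSet (cantorCylinder σ) := by
  have : cantorCylinder σ = ⋂ i : Fin σ.length, (fun x : ℕ → Bool => x i) ⁻¹' {σ.get i} := by
    ext x; simp [cantorCylinder]
  rw [this]
  exact MeasurableSet.iInter fun i => measurable_pi_apply _ (measurableSet_singleton _)

theorem measurableSet_ratBall (b : ℕ × ℕ × ℕ) : MeasurableSet (ratBall b) :=
  (isOpen_lt (by fun_prop) (by fun_prop)).measurableSet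

theorem disjoint_cantorCylinder_bitString {n m m' : ℕ} (hm : m < 2 ^ n) (hm' : m' < 2 ^ n)
    (h : m ≠ m') :
    Disjoint (cantorCylinder (bitString n m)) (cantorCylinder (bitString n m')) := by
  refine Set.disjoint_left.2 fun x hx hx' => h (Nat.eq_of_testBit_eq fun i => ?_)
  rw [mem_cantorCylinder_bitString] at hx hx'
  by_cases hi : i < n
  · rw [← hx i hi, hx' i hi]
  · have hp : 2 ^ n ≤ 2 ^ i := Nat.pow_le_pow_right (by norm_num) (not_lt.1 hi)
    rw [Nat.testBit_lt_two_pow (hm.trans_le hp), Nat.testBit_lt_two_pow (hm'.trans_le hp)]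

/-- The measure of an event that depends on the first `n` bits only. -/
theorem measureReal_eq_sum_bitString (ν : Measure (ℕ → Bool)) [IsProbabilityMeasure ν] {n : ℕ}
    {P : (ℕ → Bool) → Prop} [DecidablePred P]
    (hP : ∀ x y : ℕ → Bool, (∀ i < n, x i = y i) → (P x ↔ P y)) :
    ν.real {x | P x} = ∑ m ∈ Finset.range (2 ^ n),
      if P m.testBit then ν.real (cantorCylinder (bitString n m)) else 0 := by
  rw [← Finset.sum_filter, ← measureReal_biUnion_finset]
  · congr 1
    ext x
    simp only [Set.mem_ofPred_eq, Set.mem_iUnion, Finset.mem_filter, Finset.mem_range, exists_prop]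
    constructor
    · intro hx
      have ht : ∀ i < n, x i = (Nat.ofBits fun i : Fin n => x i).testBit i := fun i hi => by
        rw [Nat.testBit_ofBits_lt _ _ hi]
      exact ⟨_, ⟨Nat.ofBits_lt_two_pow _, (hP _ _ ht).1 hx⟩, mem_cantorCylinder_bitString.2 ht⟩
    · rintro ⟨m, ⟨-, hm⟩, hx⟩
      exact (hP _ _ (mem_cantorCylinder_bitString.1 hx)).2 hm
  · intro m hm m' hm' h
    simp only [Finset.coe_filter, Finset.mem_range, Set.mem_ofPred_eq] at hm hm'
    exact disjoint_cantorCylinder_bitString hm.1 hm'.1 h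
  · exact fun m _ => measurableSet_cantorCylinder _

theorem clampedCertified_congr {b : ℕ × ℕ × ℕ} {c k : ℕ} {x y : ℕ → Bool}
    (h : ∀ i < 16 ^ k, x i = y i) : ClampedCertified b c x k ↔ ClampedCertified b c y k := by
  rw [ClampedCertified, ClampedCertified, clampedCount_congr h]

/-- The mixture of the distributions of the random variables `clampedLimit c` under `ν`. -/
noncomputable def clampedMeasure (ν : Measure (ℕ → Bool)) : Measure unitInterval :=
  Measure.sum fun c : ℕ => (2 : ENNReal)⁻¹ ^ (c + 1) • ν.map (clampedLimit c)

theorem tsum_two_inv_pow_succ : ∑' c : ℕ, (2 : ENNReal)⁻¹ ^ (c + 1) = 1 := by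
  simp_rw [pow_succ]
  rw [ENNReal.tsum_mul_right, ENNReal.tsum_geometric, ENNReal.one_sub_inv_two, inv_inv]
  exact ENNReal.mul_inv_cancel (by norm_num) (by norm_num)

theorem clampedMeasure_apply (ν : Measure (ℕ → Bool)) {s : Set unitInterval} (hs : MeasurableSet s) :
    clampedMeasure ν s = ∑' c : ℕ, (2 : ENNReal)⁻¹ ^ (c + 1) * ν (clampedLimit c ⁻¹' s) := by
  rw [clampedMeasure, Measure.sum_apply _ hs]
  simp [Measure.map_apply (measurable_clampedLimit _) hs]

variable (ν : Measure (ℕ → Bool)) [IsProbabilityMeasure ν]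

instance isProbabilityMeasure_clampedMeasure : IsProbabilityMeasure (clampedMeasure ν) :=
  ⟨by simp [clampedMeasure_apply ν MeasurableSet.univ, tsum_two_inv_pow_succ]⟩

theorem hasSum_clampedMeasure {s : Set unitInterval} (hs : MeasurableSet s) :
    HasSum (fun c : ℕ => (1 / 2 : ℝ) ^ (c + 1) * ν.real (clampedLimit c ⁻¹' s))
      ((clampedMeasure ν).real s) := by
  have hne : ∑' c : ℕ, (2 : ENNReal)⁻¹ ^ (c + 1) * ν (clampedLimit c ⁻¹' s) ≠ ⊤ := by
    rw [← clampedMeasure_apply ν hs]; exact measure_ne_top _ _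
  have := ENNReal.hasSum_toReal hne
  rw [← ENNReal.tsum_toReal_eq (fun c => ENNReal.ne_top_of_tsum_ne_top hne c),
    ← clampedMeasure_apply ν hs] at this
  simpa [measureReal_def] using this

/-- Continuity from below, since certificates persist as k grows. -/
theorem tendsto_measureReal_clampedCertified (b : ℕ × ℕ × ℕ) (c : ℕ) :
    Filter.Tendsto (fun k => ν.real {x | ClampedCertified b c x k}) Filter.atTop
      (nhds (ν.real (clampedLimit c ⁻¹' ratBall b))) := by
  have : clampedLimit c ⁻¹' ratBall b = ⋃ k, {x | ClampedCertified b c x k} := by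
    ext x; simp [clampedLimit_mem_ratBall]
  rw [this]
  refine (ENNReal.tendsto_toReal (measure_ne_top _ _)).comp (tendsto_measure_iUnion_atTop ?_)
  exact fun k l h x hx => clampedCertified_mono b c x h hx

theorem measureReal_clampedCertified_le (b : ℕ × ℕ × ℕ) (c k : ℕ) :
    ν.real {x | ClampedCertified b c x k} ≤ ν.real (clampedLimit c ⁻¹' ratBall b) :=
  measureReal_mono fun _ hx => clampedLimit_mem_ratBall.2 ⟨k, hx⟩

/-- The approximation to the measure of the ball with code `b` that takes into account the first
`C` components of the mixture, the clamped frequencies of index `k`, and approximations with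
precision `n` to the measures of cylinders. -/
noncomputable def clampedApprox (f : List Bool → ℕ → ℕ) (b : ℕ × ℕ × ℕ) (C k n : ℕ) : ℝ :=
  ∑ c ∈ Finset.range C, (1 / 2 : ℝ) ^ (c + 1) * ∑ m ∈ Finset.range (2 ^ 16 ^ k),
    if ClampedCertified b c m.testBit k then (f (bitString (16 ^ k) m) n : ℝ) / 2 ^ n else 0

variable {ν} {f : List Bool → ℕ → ℕ}

/-! ### Approximation of the mixture from below -/

theorem sum_half_pow_succ_le (C : ℕ) : ∑ c ∈ Finset.range C, (1 / 2 : ℝ) ^ (c + 1) ≤ 1 := by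
  have : ∀ C : ℕ, ∑ c ∈ Finset.range C, (1 / 2 : ℝ) ^ (c + 1) = 1 - (1 / 2) ^ C := by
    intro C
    induction C with
    | zero => simp
    | succ C ih => rw [Finset.sum_range_succ, ih]; ring
  rw [this]
  linarith [show (0 : ℝ) ≤ (1 / 2) ^ C by positivity]

/-- Each of the at most 2 ^ 16 ^ k cylinders contributes an error of at most 1 / 2 ^ n, and the
weights add up to at most 1. -/
theorem clampedApprox_le
    (hf : ∀ σ n, |ν.real (cantorCylinder σ) - (f σ n : ℝ) / 2 ^ n| ≤ 1 / 2 ^ n)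
    (b : ℕ × ℕ × ℕ) (C k n : ℕ) :
    clampedApprox f b C k n ≤ (clampedMeasure ν).real (ratBall b) + 2 ^ 16 ^ k / 2 ^ n := by
  have hinner : ∀ c, (∑ m ∈ Finset.range (2 ^ 16 ^ k),
      if ClampedCertified b c m.testBit k then (f (bitString (16 ^ k) m) n : ℝ) / 2 ^ n else 0)
      ≤ ν.real (clampedLimit c ⁻¹' ratBall b) + 2 ^ 16 ^ k / 2 ^ n := by
    intro c
    refine le_trans ?_ (add_le_add_left (measureReal_clampedCertified_le ν b c k) _)
    rw [measureReal_eq_sum_bitString ν (n := 16 ^ k) fun x y h => clampedCertified_congr h]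
    have hc : (2 ^ 16 ^ k / 2 ^ n : ℝ) = ∑ m ∈ Finset.range (2 ^ 16 ^ k), (1 / 2 ^ n : ℝ) := by
      simp [div_eq_mul_inv]
    rw [hc, ← Finset.sum_add_distrib]
    refine Finset.sum_le_sum fun m _ => ?_
    have := (abs_le.1 (hf (bitString (16 ^ k) m) n)).1
    split_ifs
    · linarith
    · positivity
  calc clampedApprox f b C k n
      ≤ ∑ c ∈ Finset.range C, (1 / 2 : ℝ) ^ (c + 1)
          * (ν.real (clampedLimit c ⁻¹' ratBall b) + 2 ^ 16 ^ k / 2 ^ n) :=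
        Finset.sum_le_sum fun c _ => mul_le_mul_of_nonneg_left (hinner c) (by positivity)
    _ = ∑ c ∈ Finset.range C, (1 / 2 : ℝ) ^ (c + 1) * ν.real (clampedLimit c ⁻¹' ratBall b)
          + (∑ c ∈ Finset.range C, (1 / 2 : ℝ) ^ (c + 1)) * (2 ^ 16 ^ k / 2 ^ n) := by
        rw [Finset.sum_mul, ← Finset.sum_add_distrib]
        exact Finset.sum_congr rfl fun c _ => mul_add _ _ _
    _ ≤ _ := add_le_add
        (sum_le_hasSum _ (fun c _ => by positivity)
          (hasSum_clampedMeasure ν (measurableSet_ratBall b)))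
        (mul_le_of_le_one_left (by positivity) (sum_half_pow_succ_le C))

theorem tendsto_clampedApprox
    (hf : ∀ σ n, |ν.real (cantorCylinder σ) - (f σ n : ℝ) / 2 ^ n| ≤ 1 / 2 ^ n)
    (b : ℕ × ℕ × ℕ) (C k : ℕ) :
    Filter.Tendsto (clampedApprox f b C k) Filter.atTop (nhds (∑ c ∈ Finset.range C,
      (1 / 2 : ℝ) ^ (c + 1) * ν.real {x | ClampedCertified b c x k})) := by
  refine tendsto_finsetSum _ fun c _ => Filter.Tendsto.const_mul _ ?_
  rw [measureReal_eq_sum_bitString ν (n := 16 ^ k) fun x y h => clampedCertified_congr h]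
  refine tendsto_finsetSum _ fun m _ => ?_
  split_ifs
  · rw [tendsto_iff_dist_tendsto_zero]
    refine squeeze_zero (fun _ => dist_nonneg) (fun n => ?_) (tendsto_pow_div_two_pow 1)
    rw [dist_comm, Real.dist_eq]
    exact hf _ n
  · exact tendsto_const_nhds

/-- For the forward direction C, k and n are chosen in this order, each by a limit; the error
allowance vanishes as n grows with k fixed. -/
theorem lt_clampedMeasure_iff
    (hf : ∀ σ n, |ν.real (cantorCylinder σ) - (f σ n : ℝ) / 2 ^ n| ≤ 1 / 2 ^ n)
    (b : ℕ × ℕ × ℕ) (q : ℝ) :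
    q < (clampedMeasure ν).real (ratBall b) ↔
      ∃ C k n, q + 2 ^ 16 ^ k / 2 ^ n < clampedApprox f b C k n := by
  constructor
  · intro h
    obtain ⟨C, hC⟩ := ((hasSum_clampedMeasure ν (measurableSet_ratBall b)).tendsto_sum_nat.eventually
      (lt_mem_nhds h)).exists
    have hk : Filter.Tendsto (fun k => ∑ c ∈ Finset.range C, (1 / 2 : ℝ) ^ (c + 1)
        * ν.real {x | ClampedCertified b c x k}) Filter.atTop (nhds (∑ c ∈ Finset.range C,
          (1 / 2 : ℝ) ^ (c + 1) * ν.real (clampedLimit c ⁻¹' ratBall b))) :=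
      tendsto_finsetSum _ fun c _ => (tendsto_measureReal_clampedCertified ν b c).const_mul _
    obtain ⟨k, hk⟩ := (hk.eventually (lt_mem_nhds hC)).exists
    have hn := (tendsto_clampedApprox hf b C k).sub (tendsto_pow_div_two_pow (2 ^ 16 ^ k))
    rw [sub_zero] at hn
    obtain ⟨n, hn⟩ := (hn.eventually (lt_mem_nhds hk)).exists
    exact ⟨C, k, n, lt_sub_iff_add_lt.1 hn⟩
  · rintro ⟨C, k, n, h⟩
    have := clampedApprox_le hf b C k n
    linarith

theorem clampedApprox_eq (f : List Bool → ℕ → ℕ) (b : ℕ × ℕ × ℕ) (C k n : ℕ) :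
    clampedApprox f b C k n = ((∑ c ∈ Finset.range C, ∑ m ∈ Finset.range (2 ^ 16 ^ k),
      if ClampedCertified b c m.testBit k then 2 ^ (C - 1 - c) * f (bitString (16 ^ k) m) n else 0 :
        ℕ) : ℝ) / (2 ^ C * 2 ^ n) := by
  rw [clampedApprox]
  push_cast
  rw [Finset.sum_div]
  refine Finset.sum_congr rfl fun c hc => ?_
  rw [Finset.mul_sum, Finset.sum_div]
  refine Finset.sum_congr rfl fun m _ => ?_
  have hC : C = c + 1 + (C - 1 - c) := by have := Finset.mem_range.1 hc; omega
  split_ifs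
  · have : (2 : ℝ) ^ C = 2 ^ (c + 1) * 2 ^ (C - 1 - c) := by rw [← pow_add, ← hC]
    rw [this, one_div, inv_pow]
    field_simp
  · simp

theorem primrec_bitString : Primrec₂ bitString :=
  Primrec.list_map (Primrec.list_range.comp Primrec.fst)
    (Primrec.nat_testBit.comp (Primrec.snd.comp Primrec.fst) Primrec.snd)

theorem isComputableUnitMeasure_clampedMeasure (hν : IsComputableCantorMeasure ν) :
    IsComputableUnitMeasure (clampedMeasure ν) := by
  obtain ⟨f, hfc, hf⟩ := hν
  have hpow : ∀ {γ : Type} [Primcodable γ] {e : γ → ℕ} (m : ℕ), Primrec e →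
      Primrec fun a => m ^ e a := fun m h => Primrec.nat_pow.comp (Primrec.const m) h
  let A : (ℕ × ℕ × ℕ) → ℕ → ℕ → ℕ → ℕ := fun b C k n =>
    ∑ c ∈ Finset.range C, ∑ m ∈ Finset.range (2 ^ 16 ^ k),
      if ClampedCertified b c m.testBit k then 2 ^ (C - 1 - c) * f (bitString (16 ^ k) m) n else 0
  have hA : Computable fun r : (ℕ × ℕ × ℕ) × ℕ × ℕ × ℕ => A r.1 r.2.1 r.2.2.1 r.2.2.2 := by
    refine Computable.sum_range (f := fun (r : (ℕ × ℕ × ℕ) × ℕ × ℕ × ℕ) c =>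
      ∑ m ∈ Finset.range (2 ^ 16 ^ r.2.2.1), if ClampedCertified r.1 c m.testBit r.2.2.1 then
        2 ^ (r.2.1 - 1 - c) * f (bitString (16 ^ r.2.2.1) m) r.2.2.2 else 0) ?_
      (Primrec.fst.comp Primrec.snd).to_comp
    refine Computable.sum_range (f := fun (s : ((ℕ × ℕ × ℕ) × ℕ × ℕ × ℕ) × ℕ) m =>
      if ClampedCertified s.1.1 s.2 m.testBit s.1.2.2.1 then
        2 ^ (s.1.2.1 - 1 - s.2) * f (bitString (16 ^ s.1.2.2.1) m) s.1.2.2.2 else 0) ?_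
      (hpow 2 (hpow 16 (Primrec.fst.comp (Primrec.snd.comp (Primrec.snd.comp
        Primrec.fst))))).to_comp
    have hk : Primrec fun t : (((ℕ × ℕ × ℕ) × ℕ × ℕ × ℕ) × ℕ) × ℕ => t.1.1.2.2.1 :=
      Primrec.fst.comp (Primrec.snd.comp (Primrec.snd.comp (Primrec.fst.comp Primrec.fst)))
    have hb : Primrec fun t : (((ℕ × ℕ × ℕ) × ℕ × ℕ × ℕ) × ℕ) × ℕ => t.1.1.1 :=
      Primrec.fst.comp (Primrec.fst.comp Primrec.fst)
    have hC : Primrec fun t : (((ℕ × ℕ × ℕ) × ℕ × ℕ × ℕ) × ℕ) × ℕ => t.1.1.2.1 :=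
      Primrec.fst.comp (Primrec.snd.comp (Primrec.fst.comp Primrec.fst))
    have hn : Primrec fun t : (((ℕ × ℕ × ℕ) × ℕ × ℕ × ℕ) × ℕ) × ℕ => t.1.1.2.2.2 :=
      Primrec.snd.comp (Primrec.snd.comp (Primrec.snd.comp (Primrec.fst.comp Primrec.fst)))
    have hc : Primrec fun t : (((ℕ × ℕ × ℕ) × ℕ × ℕ × ℕ) × ℕ) × ℕ => t.1.2 :=
      Primrec.snd.comp Primrec.fst
    have hcert := primrec_clampedCertified
      (x := fun t : (((ℕ × ℕ × ℕ) × ℕ × ℕ × ℕ) × ℕ) × ℕ => t.2.testBit)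
      (Primrec.nat_testBit.comp (Primrec.snd.comp Primrec.fst) Primrec.snd) hb hc hk
    refine (Computable.cond hcert.decide.to_comp (Primrec.nat_mul.to_comp.comp
      (hpow 2 (Primrec.nat_sub.comp (Primrec.nat_sub.comp hC (Primrec.const 1)) hc)).to_comp
      (hfc.comp (primrec_bitString.comp (hpow 16 hk) Primrec.snd).to_comp hn.to_comp))
      (Computable.const 0)).of_eq fun t => ?_
    simp only [Bool.cond_decide]
  -- Here r is the triple (C, k, n), and both sides are multiplied by (q.2.2 + 1) * 2 ^ C * 2 ^ n to
  -- compare natural numbers.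
  have hlt : ∀ (q : (ℕ × ℕ × ℕ) × ℕ × ℕ), (q.2.1 : ℝ) / (q.2.2 + 1)
      < (clampedMeasure ν).real (ratBall q.1) ↔ ∃ r : ℕ × ℕ × ℕ,
        q.2.1 * 2 ^ r.1 * 2 ^ r.2.2 + 2 ^ 16 ^ r.2.1 * 2 ^ r.1 * (q.2.2 + 1)
          < (q.2.2 + 1) * A q.1 r.1 r.2.1 r.2.2 := by
    intro q
    rw [lt_clampedMeasure_iff hf]
    simp only [Prod.exists]
    refine exists_congr fun C => exists_congr fun k => exists_congr fun n => ?_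
    rw [clampedApprox_eq, lt_div_iff₀ (by positivity), ← Nat.cast_lt (α := ℝ),
      ← mul_lt_mul_iff_right₀ (show (0 : ℝ) < q.2.2 + 1 by positivity)]
    refine iff_of_eq (congrArg₂ _ ?_ ?_)
    · push_cast
      field_simp
    · simp only [A]
      push_cast
      rfl
  refine (REPred.exists (β := ℕ × ℕ × ℕ) (ComputablePred.to_re (ComputablePred.nat_lt
    (f := fun s : ((ℕ × ℕ × ℕ) × ℕ × ℕ) × ℕ × ℕ × ℕ => s.1.2.1 * 2 ^ s.2.1 * 2 ^ s.2.2.2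
      + 2 ^ 16 ^ s.2.2.1 * 2 ^ s.2.1 * (s.1.2.2 + 1))
    (g := fun s : ((ℕ × ℕ × ℕ) × ℕ × ℕ) × ℕ × ℕ × ℕ =>
      (s.1.2.2 + 1) * A s.1.1 s.2.1 s.2.2.1 s.2.2.2) ?_ ?_))).of_eq fun q => (hlt q).symm
  · have h2C : Primrec fun s : ((ℕ × ℕ × ℕ) × ℕ × ℕ) × ℕ × ℕ × ℕ => 2 ^ s.2.1 :=
      hpow 2 (Primrec.fst.comp Primrec.snd)
    exact (Primrec.nat_add.comp (Primrec.nat_mul.comp (Primrec.nat_mul.comp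
      (Primrec.fst.comp (Primrec.snd.comp Primrec.fst)) h2C)
        (hpow 2 (Primrec.snd.comp (Primrec.snd.comp Primrec.snd))))
      (Primrec.nat_mul.comp (Primrec.nat_mul.comp
        (hpow 2 (hpow 16 (Primrec.fst.comp (Primrec.snd.comp Primrec.snd)))) h2C)
        (Primrec.succ.comp (Primrec.snd.comp (Primrec.snd.comp Primrec.fst))))).to_comp
  · have h1 : Primrec fun s : ((ℕ × ℕ × ℕ) × ℕ × ℕ) × ℕ × ℕ × ℕ => s.1.2.2 + 1 :=
      Primrec.succ.comp (Primrec.snd.comp (Primrec.snd.comp Primrec.fst))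
    have h2 : Primrec fun s : ((ℕ × ℕ × ℕ) × ℕ × ℕ) × ℕ × ℕ × ℕ => (s.1.1, s.2) :=
      (Primrec.fst.comp Primrec.fst).pair Primrec.snd
    have h3 := hA.comp h2.to_comp
    exact Primrec.nat_mul.to_comp.comp h1.to_comp h3

/-! ### Frequencies in Bernoulli random sequences -/

/-- The integer whose binary digits are the first `m` bits of the binary expansion of `p`. -/
noncomputable def binaryPrefix (p : unitInterval) (m : ℕ) : ℕ := ⌈(p : ℝ) * 2 ^ m⌉₊ - 1

theorem binaryPrefix_zero (p : unitInterval) : binaryPrefix p 0 = 0 := by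
  have : ⌈(p : ℝ)⌉₊ ≤ 1 := Nat.ceil_le.2 (by simpa using p.2.2)
  simp [binaryPrefix, Nat.sub_eq_zero_of_le this]

theorem binaryPrefix_succ (p : unitInterval) (m : ℕ) :
    binaryPrefix p (m + 1) = 2 * binaryPrefix p m + binaryBit p m := by
  rcases eq_or_lt_of_le p.2.1 with h0 | h0
  · simp [binaryPrefix, binaryBit, ← h0]
  · have hpos : 0 < ⌈(p : ℝ) * 2 ^ m⌉₊ := Nat.ceil_pos.2 (by positivity)
    have h1 : ⌈(p : ℝ) * 2 ^ (m + 1)⌉₊ ≤ 2 * ⌈(p : ℝ) * 2 ^ m⌉₊ := by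
      apply Nat.ceil_le.2
      have := Nat.le_ceil ((p : ℝ) * 2 ^ m)
      push_cast
      rw [pow_succ]
      linarith
    have h2 : 2 * (⌈(p : ℝ) * 2 ^ m⌉₊ - 1) < ⌈(p : ℝ) * 2 ^ (m + 1)⌉₊ := by
      apply Nat.lt_ceil.2
      have := Nat.ceil_lt_add_one (show 0 ≤ (p : ℝ) * 2 ^ m by positivity)
      rw [Nat.cast_mul, Nat.cast_sub hpos, pow_succ]
      push_cast
      linarith
    rw [binaryPrefix, binaryPrefix, binaryBit]
    omega

theorem abs_binaryPrefix_sub_le (p : unitInterval) (m : ℕ) :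
    |(binaryPrefix p m : ℝ) / 2 ^ m - p| ≤ 1 / 2 ^ m := by
  have h2 : (0 : ℝ) < 2 ^ m := by positivity
  have hp : 0 ≤ (p : ℝ) * 2 ^ m := mul_nonneg p.2.1 h2.le
  have h3 := Nat.le_ceil ((p : ℝ) * 2 ^ m)
  have h4 := Nat.ceil_lt_add_one hp
  have h5 : (⌈(p : ℝ) * 2 ^ m⌉₊ : ℝ) ≤ binaryPrefix p m + 1 := by
    have : ⌈(p : ℝ) * 2 ^ m⌉₊ ≤ binaryPrefix p m + 1 := by rw [binaryPrefix]; omega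
    exact_mod_cast this
  have h6 : (binaryPrefix p m : ℝ) ≤ p * 2 ^ m := by
    rcases Nat.eq_zero_or_pos ⌈(p : ℝ) * 2 ^ m⌉₊ with h | h
    · rw [binaryPrefix, h]; simpa using hp
    · rw [binaryPrefix, Nat.cast_sub h]; push_cast; linarith
  rw [abs_le, div_sub' h2.ne', neg_le, ← neg_div, div_le_div_iff_of_pos_right h2,
    div_le_div_iff_of_pos_right h2]
  constructor <;> linarith

theorem recursiveIn_binaryPrefix (p : unitInterval) :
    Nat.RecursiveIn {realOracle p} fun m => Part.some (binaryPrefix p m) := by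
  have hbit : Nat.RecursiveIn {realOracle p} fun n => Part.some (binaryBit p n) :=
    .oracle _ rfl
  -- The recursion step receives a dummy parameter, an index y and the previous prefix v: `hidx`
  -- extracts y for the oracle, `hsnd` keeps the pair of y and v, and `hadd` forms 2 * v plus the
  -- bit.
  have hadd : Nat.Primrec fun n => 2 * n.unpair.2.unpair.2 + n.unpair.1 :=
    Primrec.nat_iff.1 (Primrec.nat_add.comp
      (Primrec.nat_mul.comp (Primrec.const 2) (Primrec.snd.comp (Primrec.unpair.comp
        (Primrec.snd.comp Primrec.unpair)))) (Primrec.fst.comp Primrec.unpair))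
  have hidx : Nat.Primrec fun n => n.unpair.2.unpair.1 :=
    Primrec.nat_iff.1 (Primrec.fst.comp (Primrec.unpair.comp (Primrec.snd.comp Primrec.unpair)))
  have hsnd : Nat.Primrec fun n => n.unpair.2 :=
    Primrec.nat_iff.1 (Primrec.snd.comp Primrec.unpair)
  have hstart : Nat.Primrec fun m => Nat.pair 0 m :=
    Primrec.nat_iff.1 (Primrec₂.natPair.comp (Primrec.const 0) Primrec.id)
  have hstep := hadd.recursiveIn (O := {realOracle p}) |>.comp
    ((hbit.comp hidx.recursiveIn).pair hsnd.recursiveIn)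
  have h := (Nat.RecursiveIn.prec (O := {realOracle p}) .zero hstep).comp hstart.recursiveIn
  refine h.of_eq fun m => ?_
  simp only [Part.coe_some, Part.bind_eq_bind, Part.bind_some, Nat.unpair_pair]
  induction m with
  | zero => rw [binaryPrefix_zero]; rfl
  | succ m ih =>
    simp only [ih, binaryPrefix_succ]
    simp [Seq.seq]

theorem memLp_zeroIndicator (p : unitInterval) (i : ℕ) :
    MemLp (fun x : ℕ → Bool => if x i then (0 : ℝ) else 1) 2 (bernoulliSeq p) := by
  have : IsProbabilityMeasure (bernoulliSeq p) := by unfold bernoulliSeq; infer_instance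
  refine MemLp.of_bound (C := 1) ?_ (ae_of_all _ fun x => by split_ifs <;> simp)
  exact ((measurable_of_countable fun b : Bool => if b then (0 : ℝ) else 1).comp
    (measurable_pi_apply i)).aestronglyMeasurable

theorem integral_zeroIndicator (p : unitInterval) (i : ℕ) :
    ∫ x, (if x i then (0 : ℝ) else 1) ∂bernoulliSeq p = p := by
  have hm : Measurable fun b : Bool => if b then (0 : ℝ) else 1 := measurable_of_countable _
  have h : ∫ b, (if b then (0 : ℝ) else 1) ∂((bernoulliSeq p).map fun x => x i)
      = ∫ x, (if x i then (0 : ℝ) else 1) ∂bernoulliSeq p :=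
    integral_map (measurable_pi_apply i).aemeasurable hm.aestronglyMeasurable
  rw [← h, bernoulliSeq, Measure.infinitePi_map_eval, integral_bernoulliMeasure]
  simp

/-- Chebyshev's inequality for a sum of independent indicators, with each variance crudely bounded
by 1. -/
theorem bernoulliSeq_deviation_le (p : unitInterval) {n : ℕ} (hn : 0 < n) {δ : ℝ} (hδ : 0 < δ) :
    bernoulliSeq p {x | δ ≤ |(zeroCount x n : ℝ) / n - p|} ≤ ENNReal.ofReal (1 / (n * δ ^ 2)) := by
  have : IsProbabilityMeasure (bernoulliSeq p) := by unfold bernoulliSeq; infer_instance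
  let X : ℕ → (ℕ → Bool) → ℝ := fun i x => if x i then 0 else 1
  have hX : ∀ i, MemLp (X i) 2 (bernoulliSeq p) := memLp_zeroIndicator p
  have hn' : (0 : ℝ) < n := by exact_mod_cast hn
  have hind : iIndepFun X (bernoulliSeq p) :=
    iIndepFun_infinitePi (X := fun _ (b : Bool) => if b then (0 : ℝ) else 1)
      fun _ => measurable_of_countable _
  have hvar : variance (∑ i ∈ Finset.range n, X i) (bernoulliSeq p) ≤ n := by
    rw [IndepFun.variance_sum (fun i _ => hX i) fun i _ j _ h => hind.indepFun h]
    refine (Finset.sum_le_card_nsmul _ _ 1 fun i _ => ?_).trans (by simp)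
    have := variance_le_sq_of_bounded (a := 0) (b := 1) (X := X i) (μ := bernoulliSeq p)
      (ae_of_all _ fun x => by simp only [X]; split_ifs <;> simp) (hX i).1.aemeasurable
    linarith
  have hmean : ∫ x, (∑ i ∈ Finset.range n, X i) x ∂bernoulliSeq p = n * p := by
    simp only [Finset.sum_apply]
    rw [integral_finsetSum _ fun i _ => (hX i).integrable (by norm_num)]
    simp [X, integral_zeroIndicator]
  have hcount : ∀ x, (zeroCount x n : ℝ) = (∑ i ∈ Finset.range n, X i) x := fun x => by
    simp [zeroCount, X]
  have hch := meas_ge_le_variance_div_sq (memLp_finsetSum' (Finset.range n) fun i _ => hX i)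
    (mul_pos hn' hδ)
  rw [hmean] at hch
  refine le_trans (measure_mono fun x hx => ?_) (hch.trans (ENNReal.ofReal_le_ofReal ?_))
  · simp only [Set.mem_ofPred_eq] at hx ⊢
    rw [← hcount, show (zeroCount x n : ℝ) - n * p = n * (zeroCount x n / n - p) by field_simp,
      abs_mul, abs_of_pos hn']
    exact mul_le_mul_of_nonneg_left hx hn'.le
  · rw [show 1 / ((n : ℝ) * δ ^ 2) = n / (n * δ) ^ 2 by field_simp]
    gcongr

/-! ### The deviation test relative to the parameter -/

theorem getD_eq_of_mem_cantorCylinder {σ : List Bool} {x : ℕ → Bool} (hx : x ∈ cantorCylinder σ)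
    {i : ℕ} (hi : i < σ.length) : σ.getD i false = x i := by
  rw [List.getD_eq_getElem _ _ hi]
  exact (hx ⟨i, hi⟩).symm

theorem exists_length_eq_mem_cantorCylinder (x : ℕ → Bool) (n : ℕ) :
    ∃ σ : List Bool, σ.length = n ∧ x ∈ cantorCylinder σ :=
  ⟨(List.range n).map x, by simp, fun i => by
    show x i = ((List.range n).map x)[(i : ℕ)]
    simp⟩

/-- The frequency of zeros in `σ` has distance at least `1 / 2 ^ k` from `m / 2 ^ σ.length`, and
the length of `σ` is `16 ^ k`. -/
def FrequencyDeviates (σ : List Bool) (m k : ℕ) : Prop :=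
  σ.length = 16 ^ k ∧
    (16 ^ k * 2 ^ σ.length + m * 16 ^ k * 2 ^ k
        ≤ zeroCount (fun i => σ.getD i false) σ.length * 2 ^ σ.length * 2 ^ k ∨
      16 ^ k * 2 ^ σ.length + zeroCount (fun i => σ.getD i false) σ.length * 2 ^ σ.length * 2 ^ k
        ≤ m * 16 ^ k * 2 ^ k)

theorem frequencyDeviates_iff {σ : List Bool} {m k : ℕ} (hσ : σ.length = 16 ^ k) {x : ℕ → Bool}
    (hx : x ∈ cantorCylinder σ) : FrequencyDeviates σ m k ↔
      1 / 2 ^ k ≤ |(zeroCount x (16 ^ k) : ℝ) / 16 ^ k - m / 2 ^ 16 ^ k| := by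
  have hz : zeroCount (fun i => σ.getD i false) σ.length = zeroCount x (16 ^ k) := by
    rw [← hσ]
    exact zeroCount_congr fun i hi => getD_eq_of_mem_cantorCylinder hx hi
  have hM : (0 : ℝ) < 16 ^ k * 2 ^ 16 ^ k * 2 ^ k := by positivity
  rw [FrequencyDeviates, hz, hσ, eq_self_iff_true, true_and, le_abs, neg_sub,
    ← Nat.cast_le (α := ℝ), ← Nat.cast_le (α := ℝ)]
  push_cast
  have aux : ∀ {a b c d : ℝ}, b - a = 16 ^ k * 2 ^ 16 ^ k * 2 ^ k * (d - c) →
      (a ≤ b ↔ c ≤ d) := by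
    intro a b c d h
    rw [← sub_nonneg, h, mul_nonneg_iff_of_pos_left hM, sub_nonneg]
  refine or_congr (aux ?_) (aux ?_)
  · field_simp
    ring
  · field_simp
    ring

theorem primrecPred_frequencyDeviates :
    PrimrecPred fun q : List Bool × ℕ × ℕ => FrequencyDeviates q.1 q.2.1 q.2.2 := by
  have hlen : Primrec fun q : List Bool × ℕ × ℕ => q.1.length :=
    Primrec.list_length.comp Primrec.fst
  have hm : Primrec fun q : List Bool × ℕ × ℕ => q.2.1 := Primrec.fst.comp Primrec.snd
  have hk : Primrec fun q : List Bool × ℕ × ℕ => q.2.2 := Primrec.snd.comp Primrec.snd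
  have h16 : Primrec fun q : List Bool × ℕ × ℕ => 16 ^ q.2.2 :=
    Primrec.nat_pow.comp (Primrec.const 16) hk
  have h2 : Primrec fun q : List Bool × ℕ × ℕ => 2 ^ q.2.2 :=
    Primrec.nat_pow.comp (Primrec.const 2) hk
  have hL : Primrec fun q : List Bool × ℕ × ℕ => 2 ^ q.1.length :=
    Primrec.nat_pow.comp (Primrec.const 2) hlen
  have hS : Primrec fun q : List Bool × ℕ × ℕ =>
      zeroCount (fun i => q.1.getD i false) q.1.length :=
    (primrec_zeroCount (x := fun (σ : List Bool) i => σ.getD i false)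
      (Primrec.list_getD false)).comp Primrec.fst hlen
  have hA := Primrec.nat_mul.comp h16 hL
  have hB := Primrec.nat_mul.comp (Primrec.nat_mul.comp hm h16) h2
  have hC := Primrec.nat_mul.comp (Primrec.nat_mul.comp hS hL) h2
  exact (Primrec.eq.comp hlen h16).and
    ((Primrec.nat_le.comp (Primrec.nat_add.comp hA hB) hC).or
      (Primrec.nat_le.comp (Primrec.nat_add.comp hA hC) hB))

/-- The strings that witness a large deviation of the frequency of zeros from `p`. -/
def deviationStrings (p : unitInterval) (i : ℕ) : Set (List Bool) :=
  {σ | ∃ k, i + 3 ≤ k ∧ FrequencyDeviates σ (binaryPrefix p σ.length) k}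

/-- The oracle enters only through one prefix of p, of length `σ.length`; the rest is a decidable
condition on k. -/
theorem rePredIn_deviationStrings (p : unitInterval) :
    REPredIn {realOracle p} fun q : ℕ × List Bool => q.2 ∈ deviationStrings p q.1 := by
  have h : PrimrecPred fun r : ((ℕ × List Bool) × ℕ) × ℕ =>
      r.1.1.1 + 3 ≤ r.2 ∧ FrequencyDeviates r.1.1.2 r.1.2 r.2 := by
    refine (Primrec.nat_le.comp (Primrec.nat_add.comp
      (Primrec.fst.comp (Primrec.fst.comp Primrec.fst)) (Primrec.const 3)) Primrec.snd).and ?_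
    exact primrecPred_frequencyDeviates.comp
      ((Primrec.snd.comp (Primrec.fst.comp Primrec.fst)).pair
        ((Primrec.snd.comp Primrec.fst).pair Primrec.snd))
  exact REPredIn.of_recursiveIn (recursiveIn_binaryPrefix p) h.computablePred.to_re.exists
    (Primrec.list_length.comp Primrec.snd)

theorem binaryPrefix_error_le (p : unitInterval) (k : ℕ) :
    |(binaryPrefix p (16 ^ k) : ℝ) / 2 ^ 16 ^ k - p| ≤ 1 / 2 ^ (k + 1) := by
  refine (abs_binaryPrefix_sub_le p _).trans ?_
  gcongr
  · norm_num
  · exact Nat.lt_pow_self (by norm_num)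

/-- Replacing p by its prefix costs at most half of 1 / 2 ^ k, so the true deviation is at least 1 /
2 ^ (k + 1). Chebyshev's bound at length 16 ^ k is then 4 / 4 ^ k ≤ 4 / 2 ^ k, and the latter sums
to 2 ^ -i over k ≥ i + 3. -/
theorem isMLTest_deviationStrings (p : unitInterval) :
    IsMLTest {realOracle p} cantorCylinder (bernoulliSeq p)
      fun i => ⋃ σ ∈ deviationStrings p i, cantorCylinder σ := by
  refine ⟨⟨deviationStrings p, rePredIn_deviationStrings p, fun _ => rfl⟩, fun i => ?_⟩
  have hsub : (⋃ σ ∈ deviationStrings p i, cantorCylinder σ) ⊆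
      ⋃ j : ℕ, {x | 1 / 2 ^ (i + 3 + j + 1)
        ≤ |(zeroCount x (16 ^ (i + 3 + j)) : ℝ) / (16 ^ (i + 3 + j) : ℕ) - p|} := by
    intro x hx
    simp only [Set.mem_iUnion, exists_prop] at hx
    obtain ⟨σ, ⟨k, hk, hd⟩, hx⟩ := hx
    obtain ⟨j, rfl⟩ := Nat.exists_eq_add_of_le hk
    refine Set.mem_iUnion.2 ⟨j, ?_⟩
    have hb := binaryPrefix_error_le p (i + 3 + j)
    have h := (frequencyDeviates_iff hd.1 hx).1 hd
    rw [hd.1] at h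
    have ht := abs_sub_le ((zeroCount x (16 ^ (i + 3 + j)) : ℝ) / 16 ^ (i + 3 + j)) p
      (binaryPrefix p (16 ^ (i + 3 + j)) / 2 ^ 16 ^ (i + 3 + j))
    rw [abs_sub_comm (p : ℝ)] at ht
    have e : (1 : ℝ) / 2 ^ (i + 3 + j) = 1 / 2 ^ (i + 3 + j + 1) + 1 / 2 ^ (i + 3 + j + 1) := by
      rw [pow_succ]; field_simp; norm_num
    simp only [Set.mem_ofPred_eq]
    push_cast
    linarith
  refine (measure_mono hsub).trans ((measure_iUnion_le _).trans ?_)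
  have hterm : ∀ j : ℕ, bernoulliSeq p {x | 1 / 2 ^ (i + 3 + j + 1)
      ≤ |(zeroCount x (16 ^ (i + 3 + j)) : ℝ) / (16 ^ (i + 3 + j) : ℕ) - p|}
      ≤ (2 : ENNReal)⁻¹ ^ i * (2 : ENNReal)⁻¹ ^ (j + 1) := by
    intro j
    refine (bernoulliSeq_deviation_le p (by positivity) (by positivity)).trans ?_
    have e : (2 : ENNReal)⁻¹ ^ i * (2 : ENNReal)⁻¹ ^ (j + 1)
        = ENNReal.ofReal ((1 / 2) ^ (i + (j + 1))) := by
      rw [← pow_add, ENNReal.ofReal_pow (by norm_num), one_div,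
        ENNReal.ofReal_inv_of_pos (by norm_num), ENNReal.ofReal_ofNat]
    rw [e]
    refine ENNReal.ofReal_le_ofReal ?_
    push_cast
    have e16 : (16 : ℝ) ^ (i + 3 + j) = 2 ^ (i + 3 + j) * 2 ^ (i + 3 + j) * 4 ^ (i + 3 + j) := by
      rw [← mul_pow, ← mul_pow]; norm_num
    have h42 : (2 : ℝ) ^ (i + 3 + j) ≤ 4 ^ (i + 3 + j) := by gcongr; norm_num
    have e2 : (2 : ℝ) ^ (i + 3 + j) = 4 * 2 ^ (i + (j + 1)) := by ring
    have e4 : 1 / ((16 : ℝ) ^ (i + 3 + j) * (1 / 2 ^ (i + 3 + j + 1)) ^ 2)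
        = 4 / 4 ^ (i + 3 + j) := by
      rw [e16]
      field_simp
      ring
    rw [e4, div_pow, one_pow, div_le_div_iff₀ (by positivity) (by positivity)]
    linarith
  refine (ENNReal.tsum_le_tsum hterm).trans ?_
  rw [ENNReal.tsum_mul_left, tsum_two_inv_pow_succ, mul_one]

theorem exists_clampedLimit_eq {p : unitInterval} {x : ℕ → Bool} (hx : x ∈ bernoulliMLR p) :
    ∃ c, clampedLimit c x = p := by
  have h := hx _ (isMLTest_deviationStrings p)
  simp only [Set.mem_iInter, Set.mem_iUnion, not_forall, not_exists] at h
  obtain ⟨i, hi⟩ := h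
  -- With c = i + 3 the bound 2 ^ c / 2 ^ k is at least 1, hence trivial, for the k < i + 3 that the
  -- test ignores.
  refine ⟨i + 3, clampedLimit_eq fun k => ?_⟩
  rcases le_or_gt (i + 3) k with hk | hk
  · obtain ⟨σ, hσ, hxσ⟩ := exists_length_eq_mem_cantorCylinder x (16 ^ k)
    have hnot : ¬ FrequencyDeviates σ (binaryPrefix p σ.length) k :=
      fun hd => hi σ ⟨k, hk, hd⟩ hxσ
    rw [frequencyDeviates_iff hσ hxσ, hσ, not_le] at hnot
    have hb := binaryPrefix_error_le p k
    have ht := abs_sub_le ((zeroCount x (16 ^ k) : ℝ) / 16 ^ k)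
      (binaryPrefix p (16 ^ k) / 2 ^ 16 ^ k) p
    have h1 : (1 : ℝ) / 2 ^ (k + 1) ≤ 1 / 2 ^ k := by gcongr <;> norm_num
    have h2 : (1 : ℝ) / 2 ^ k + 1 / 2 ^ k ≤ 2 ^ (i + 3) / 2 ^ k := by
      rw [← add_div]
      gcongr
      rw [pow_succ]
      nlinarith [one_le_pow₀ (n := i + 2) (show (1 : ℝ) ≤ 2 by norm_num)]
    linarith
  · have h1 : (zeroCount x (16 ^ k) : ℝ) / 16 ^ k ≤ 1 :=
      div_le_one_of_le₀ (by exact_mod_cast zeroCount_le x (16 ^ k)) (by positivity)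
    have h0 : (0 : ℝ) ≤ (zeroCount x (16 ^ k) : ℝ) / 16 ^ k := by positivity
    have h2 : (1 : ℝ) ≤ 2 ^ (i + 3) / 2 ^ k := by
      rw [one_le_div (by positivity)]
      gcongr
      norm_num
    refine le_trans ?_ h2
    rw [abs_le]
    constructor <;> linarith [p.2.1, p.2.2]

/-! ### Preservation of randomness -/

theorem measure_preimage_clampedLimit_le (ν : Measure (ℕ → Bool)) (c : ℕ) {s : Set unitInterval}
    (hs : MeasurableSet s) : ν (clampedLimit c ⁻¹' s) ≤ 2 ^ (c + 1) * clampedMeasure ν s := by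
  have h : (2 : ENNReal)⁻¹ ^ (c + 1) * ν (clampedLimit c ⁻¹' s) ≤ clampedMeasure ν s := by
    rw [clampedMeasure_apply ν hs]
    exact ENNReal.le_tsum c
  calc ν (clampedLimit c ⁻¹' s)
      = 2 ^ (c + 1) * ((2 : ENNReal)⁻¹ ^ (c + 1) * ν (clampedLimit c ⁻¹' s)) := by
        rw [← mul_assoc, ← mul_pow, ENNReal.mul_inv_cancel (by norm_num) (by norm_num), one_pow,
          one_mul]
    _ ≤ _ := mul_le_mul_right h _

theorem isMLTest_preimage_clampedLimit {ν : Measure (ℕ → Bool)} {U : ℕ → Set unitInterval}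
    (hU : IsMLTest ∅ ratBall (clampedMeasure ν) U) (c : ℕ) :
    IsMLTest ∅ cantorCylinder ν fun i => clampedLimit c ⁻¹' U (i + (c + 1)) := by
  obtain ⟨⟨W, hW, hWU⟩, hμ⟩ := hU
  -- A certificate of index k reads only 16 ^ k bits, so the preimage is a union of cylinders of
  -- such lengths. The shift of the test by c + 1 pays for the factor 2 ^ (c + 1).
  refine ⟨⟨fun i => {σ | ∃ q : (ℕ × ℕ × ℕ) × ℕ, q.1 ∈ W (i + (c + 1)) ∧ σ.length = 16 ^ q.2 ∧
    ClampedCertified q.1 c (fun j => σ.getD j false) q.2}, ?_, fun i => ?_⟩, fun i => ?_⟩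
  · rw [rePredIn_empty_iff] at hW ⊢
    have h1 : REPred fun r : (ℕ × List Bool) × (ℕ × ℕ × ℕ) × ℕ =>
        r.2.1 ∈ W (r.1.1 + (c + 1)) :=
      hW.comp (f := fun r : (ℕ × List Bool) × (ℕ × ℕ × ℕ) × ℕ => (r.1.1 + (c + 1), r.2.1))
        ((Primrec.nat_add.comp (Primrec.fst.comp Primrec.fst) (Primrec.const (c + 1))).pair
          (Primrec.fst.comp Primrec.snd)).to_comp
    have hσ : Primrec fun r : (ℕ × List Bool) × (ℕ × ℕ × ℕ) × ℕ => r.1.2 :=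
      Primrec.snd.comp Primrec.fst
    have hk : Primrec fun r : (ℕ × List Bool) × (ℕ × ℕ × ℕ) × ℕ => r.2.2 :=
      Primrec.snd.comp Primrec.snd
    have h2 : PrimrecPred fun r : (ℕ × List Bool) × (ℕ × ℕ × ℕ) × ℕ =>
        r.1.2.length = 16 ^ r.2.2 :=
      Primrec.eq.comp (Primrec.list_length.comp hσ) (Primrec.nat_pow.comp (Primrec.const 16) hk)
    have h3 := primrec_clampedCertified
      (x := fun (r : (ℕ × List Bool) × (ℕ × ℕ × ℕ) × ℕ) j => r.1.2.getD j false)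
      ((Primrec.list_getD false).comp (hσ.comp Primrec.fst) Primrec.snd)
      (Primrec.fst.comp Primrec.snd) (Primrec.const c) hk
    exact (h1.and (h2.and h3).computablePred.to_re).exists
  · ext x
    simp only [Set.mem_preimage, hWU, Set.mem_iUnion, Set.mem_ofPred_eq, exists_prop,
      clampedLimit_mem_ratBall]
    constructor
    · rintro ⟨b, hb, k, hk⟩
      obtain ⟨σ, hσ, hxσ⟩ := exists_length_eq_mem_cantorCylinder x (16 ^ k)
      refine ⟨σ, ⟨(b, k), hb, hσ, ?_⟩, hxσ⟩
      refine (clampedCertified_congr fun i hi => ?_).2 hk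
      exact getD_eq_of_mem_cantorCylinder hxσ (hσ ▸ hi)
    · rintro ⟨σ, ⟨⟨b, k⟩, hb, hσ, hk⟩, hxσ⟩
      refine ⟨b, hb, k, (clampedCertified_congr fun i hi => ?_).1 hk⟩
      exact getD_eq_of_mem_cantorCylinder hxσ (hσ ▸ hi)
  · have hs : MeasurableSet (U (i + (c + 1))) := by
      rw [hWU]
      exact MeasurableSet.biUnion (Set.to_countable _) fun b _ => measurableSet_ratBall b
    calc ν (clampedLimit c ⁻¹' U (i + (c + 1)))
        ≤ 2 ^ (c + 1) * clampedMeasure ν (U (i + (c + 1))) :=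
          measure_preimage_clampedLimit_le ν c hs
      _ ≤ 2 ^ (c + 1) * (2 : ENNReal)⁻¹ ^ (i + (c + 1)) := mul_le_mul_right (hμ _) _
      _ = (2 : ENNReal)⁻¹ ^ i := by
          rw [pow_add _ i, mul_left_comm, ← mul_pow, ENNReal.mul_inv_cancel (by norm_num) (by norm_num),
            one_pow, mul_one]

theorem clampedLimit_mem_unitMLR {ν : Measure (ℕ → Bool)} {x : ℕ → Bool} (hx : x ∈ cantorMLR ν)
    (c : ℕ) : clampedLimit c x ∈ unitMLR (clampedMeasure ν) := by
  intro U hU hmem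
  exact hx _ (isMLTest_preimage_clampedLimit hU c)
    (Set.mem_iInter.2 fun i => Set.mem_iInter.1 hmem (i + (c + 1)))

theorem theorem3p7 (ν : Measure (ℕ → Bool)) [IsProbabilityMeasure ν]
    (hν : IsComputableCantorMeasure ν) :
    ∃ ζ : Measure unitInterval, IsProbabilityMeasure ζ ∧ IsComputableUnitMeasure ζ ∧
      ∀ p : unitInterval, (cantorMLR ν ∩ bernoulliMLR p).Nonempty → p ∈ unitMLR ζ := by
  refine ⟨clampedMeasure ν, inferInstance, isComputableUnitMeasure_clampedMeasure hν, ?_⟩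
  rintro p ⟨x, hxν, hxp⟩
  obtain ⟨c, rfl⟩ := exists_clampedLimit_eq hxp
  exact clampedLimit_mem_unitMLR hxν c
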